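/- Let $L_N[u]$ $(N\ge 0)$ be the differential polynomials in $u=u(z)$ determined by the Lenard recursion $\frac{d}{dz}L_{N+1}[u]=\left(\frac{d^3}{dz^3}+4u\frac{d}{dz}+2u_z\right)L_N[u]$, $L_0[u]=\tfrac12$, with zero integration constants (that is, $L_N[u]$ has no constant term for $N\ge1$). For $N\ge1$ and $\alpha\in\mathbb C$, the $N$-th equation of the second Painlevé hierarchy is $$\left(\frac{d}{dz}+2w\right)L_N[w'-w^2]-zw-\alpha=0 .$$ Fix $N\ge 1$ and let $Q_0^{(N)},Q_1^{(N)},Q_2^{(N)},\dots\in\mathbb C[z]$ be the associated Yablonskii–Vorob'ev polynomials: monic polynomials with $Q_0^{(N)}=1$ such that for every $n\ge1$ the rational function $$w^{(N)}(z;n)=\frac{d}{dz}\ln\frac{Q_{n-1}^{(N)}(z)}{Q_n^{(N)}(z)}$$ is a solution of the $N$-th equation with $\alpha=n$. Then for every $n\ge0$ $$\deg Q_n^{(N)}=\sum_{i=1}^n i=\frac{n(n+1)}2 .$$ -/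

import Mathlib

open MvPolynomial in
/-- The total derivative `d_z` on differential polynomials in one unknown `u`:
the variable `X k` stands for the `k`-th derivative of `u`, so `d_z (X k) = X (k + 1)`. -/
noncomputable def totalDeriv : Derivation ℚ (MvPolynomial ℕ ℚ) (MvPolynomial ℕ ℚ) :=
  mkDerivation ℚ fun k => X (k + 1)

open MvPolynomial in
/-- `L : ℕ → ℚ[u, u_z, u_zz, …]` is the sequence of Lenard differential polynomials:
`L₀ = 1/2`, `d_z L_{N+1} = (d_z³ + 4 u d_z + 2 u_z) L_N`, and no integration constants are added
(`L_{N+1}` has no constant term). -/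
structure IsLenardSequence (L : ℕ → MvPolynomial ℕ ℚ) : Prop where
  zero : L 0 = C (1 / 2)
  recursion : ∀ N, totalDeriv (L (N + 1)) =
    totalDeriv (totalDeriv (totalDeriv (L N))) + 4 * X 0 * totalDeriv (L N) + 2 * X 1 * L N
  constant_term : ∀ N, constantCoeff (L (N + 1)) = 0

open MvPolynomial in
/-- An explicit form of the Lenard differential polynomials `L_N[u]`. That this is the sequence
defined by the Lenard recursion is proved in `isLenardSequence_lenard` and
`IsLenardSequence.eq_lenard`. -/
noncomputable def lenard : ℕ → MvPolynomial ℕ ℚ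
  | 0 => C (1 / 2)
  | n + 1 =>
    (∑ i : Fin (n + 1), (2 * (lenard i * totalDeriv (totalDeriv (lenard (n - i))))
      - totalDeriv (lenard i) * totalDeriv (lenard (n - i))
      + 4 * X 0 * (lenard i * lenard (n - i))))
    - ∑ i : Fin n, lenard (i + 1) * lenard (n - i)

namespace LenardAux

open MvPolynomial Finset

theorem two_mul_lenard_zero : 2 * lenard 0 = 1 := by
  have h : (2 : MvPolynomial ℕ ℚ) = C 2 := (map_ofNat C 2).symm
  rw [lenard, h, ← C_mul]
  norm_num

theorem deriv_lenard_zero : totalDeriv (lenard 0) = 0 := by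
  rw [lenard]
  exact derivation_C _ _

theorem bilinear (n : ℕ) :
    ∑ p ∈ antidiagonal (n + 1), lenard p.1 * lenard p.2 =
      ∑ p ∈ antidiagonal n, (2 * (lenard p.1 * totalDeriv (totalDeriv (lenard p.2)))
        - totalDeriv (lenard p.1) * totalDeriv (lenard p.2)
        + 4 * X 0 * (lenard p.1 * lenard p.2)) := by
  have hrec : lenard (n + 1) =
      (∑ p ∈ antidiagonal n, (2 * (lenard p.1 * totalDeriv (totalDeriv (lenard p.2)))
        - totalDeriv (lenard p.1) * totalDeriv (lenard p.2)
        + 4 * X 0 * (lenard p.1 * lenard p.2)))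
      - ∑ i ∈ range n, lenard (i + 1) * lenard (n - i) := by
    rw [lenard, Finset.Nat.sum_antidiagonal_eq_sum_range_succ_mk,
      ← Fin.sum_univ_eq_sum_range, ← Fin.sum_univ_eq_sum_range]
  have hL : ∑ p ∈ antidiagonal (n + 1), lenard p.1 * lenard p.2 =
      2 * lenard 0 * lenard (n + 1) + ∑ i ∈ range n, lenard (i + 1) * lenard (n - i) := by
    rw [Finset.Nat.sum_antidiagonal_eq_sum_range_succ_mk, Finset.sum_range_succ,
      Finset.sum_range_succ']
    have : ∀ i ∈ range n, lenard (i + 1) * lenard (n + 1 - (i + 1)) =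
        lenard (i + 1) * lenard (n - i) := by
      intro i _
      rw [Nat.add_sub_add_right]
    rw [Finset.sum_congr rfl this]
    simp only [Nat.sub_zero, Nat.sub_self]
    ring
  rw [hL, two_mul_lenard_zero, one_mul, hrec]
  ring

theorem convolution (n : ℕ) :
    ∑ p ∈ antidiagonal n, lenard p.1 *
      (totalDeriv (totalDeriv (totalDeriv (lenard p.2))) + 4 * X 0 * totalDeriv (lenard p.2)
        + 2 * X 1 * lenard p.2 - totalDeriv (lenard (p.2 + 1))) = 0 := by
  have h := congrArg totalDeriv (bilinear n)
  have h4 : totalDeriv (4 * X 0) = 4 * X 1 := by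
    have : (4 : MvPolynomial ℕ ℚ) = C 4 := (map_ofNat C 4).symm
    rw [this, ← smul_eq_C_mul, Derivation.map_smul, totalDeriv, mkDerivation_X, smul_eq_C_mul]
  have h2 : ∀ f, totalDeriv (2 * f) = 2 * totalDeriv f := by
    intro f
    rw [two_mul, map_add, two_mul]
  simp only [map_sum, map_add, map_sub, Derivation.leibniz, h2, h4, smul_eq_mul] at h
  have s1 : ∑ p ∈ antidiagonal (n + 1),
      (lenard p.1 * totalDeriv (lenard p.2) + lenard p.2 * totalDeriv (lenard p.1)) =
      2 * ∑ p ∈ antidiagonal n, lenard p.1 * totalDeriv (lenard (p.2 + 1)) := by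
    rw [Finset.sum_add_distrib]
    have := Finset.Nat.sum_antidiagonal_swap (n := n + 1)
      (f := fun p => lenard p.1 * totalDeriv (lenard p.2))
    simp only [Prod.fst_swap, Prod.snd_swap] at this
    rw [this, Finset.Nat.sum_antidiagonal_succ', deriv_lenard_zero]
    ring
  rw [s1] at h
  have sw := Finset.Nat.sum_antidiagonal_swap (n := n)
      (f := fun p => totalDeriv (lenard p.1) * totalDeriv (totalDeriv (lenard p.2)))
  have sw2 := Finset.Nat.sum_antidiagonal_swap (n := n)
      (f := fun p => X 0 * (lenard p.1 * totalDeriv (lenard p.2)))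
  simp only [Prod.fst_swap, Prod.snd_swap] at sw sw2
  have key : 2 * ∑ p ∈ antidiagonal n, lenard p.1 *
      (totalDeriv (totalDeriv (totalDeriv (lenard p.2))) + 4 * X 0 * totalDeriv (lenard p.2)
        + 2 * X 1 * lenard p.2 - totalDeriv (lenard (p.2 + 1))) = 0 := by
    rw [← sub_eq_zero] at h sw sw2
    rw [Finset.mul_sum] at h ⊢
    rw [← Finset.sum_sub_distrib] at h sw sw2
    have e : ∀ a b c d : MvPolynomial ℕ ℚ, a = 0 → b = 0 → c = 0 →
        d = -a + b - 4 * c → d = 0 := by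
      intro a b c d ha hb hc hd
      rw [hd, ha, hb, hc]; ring
    refine e _ _ _ _ h sw sw2 ?_
    rw [Finset.mul_sum, ← Finset.sum_neg_distrib, ← Finset.sum_add_distrib,
      ← Finset.sum_sub_distrib]
    refine Finset.sum_congr rfl fun p _ => ?_
    ring
  exact (mul_eq_zero.mp key).resolve_left two_ne_zero

theorem constantCoeff_totalDeriv (f : MvPolynomial ℕ ℚ) :
    constantCoeff (totalDeriv f) = 0 := by
  induction f using MvPolynomial.induction_on with
  | C a => rw [derivation_C, map_zero]
  | add p q hp hq => rw [map_add, map_add, hp, hq, add_zero]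
  | mul_X p i hp =>
    rw [Derivation.leibniz, totalDeriv, mkDerivation_X, ← totalDeriv]
    simp

theorem constantCoeff_lenard_succ (n : ℕ) : constantCoeff (lenard (n + 1)) = 0 := by
  induction n using Nat.strong_induction_on with
  | _ n ih =>
    rw [lenard]
    simp only [map_sub, map_sum, map_add, map_mul, constantCoeff_totalDeriv, constantCoeff_X]
    rw [Finset.sum_eq_zero, Finset.sum_eq_zero, sub_zero]
    · intro i _
      rw [ih i i.2, zero_mul]
    · intro i _
      ring

theorem pderiv_totalDeriv (m : ℕ) (f : MvPolynomial ℕ ℚ) :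
    pderiv (m + 1) (totalDeriv f) = totalDeriv (pderiv (m + 1) f) + pderiv m f := by
  induction f using MvPolynomial.induction_on with
  | C a => simp [derivation_C]
  | add p q hp hq => simp only [map_add, hp, hq]; ring
  | mul_X p i hp =>
    have hX : ∀ k, totalDeriv (X k) = X (k + 1) := fun k => by rw [totalDeriv, mkDerivation_X]
    have h1 : ∀ k j, totalDeriv (pderiv k (X j)) = 0 := by
      intro k j
      by_cases h : j = k
      · subst h; rw [pderiv_X_self, Derivation.map_one_eq_zero]
      · rw [pderiv_X_of_ne h, map_zero]
    have h2 : pderiv (m + 1) (X (i + 1) : MvPolynomial ℕ ℚ) = pderiv m (X i) := by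
      by_cases h : i = m
      · subst h; rw [pderiv_X_self, pderiv_X_self]
      · rw [pderiv_X_of_ne h, pderiv_X_of_ne (by omega)]
    simp only [Derivation.leibniz, map_add, smul_eq_mul, hX, hp, h1, h2]
    ring

theorem eq_C_of_totalDeriv_eq_zero {f : MvPolynomial ℕ ℚ} (hf : totalDeriv f = 0) :
    f = C (constantCoeff f) := by
  have step : ∀ m, pderiv (m + 1) f = 0 → pderiv m f = 0 := by
    intro m hm
    have := pderiv_totalDeriv m f
    rwa [hf, hm, map_zero, map_zero, zero_add, eq_comm] at this
  obtain ⟨B, hB⟩ : ∃ B, ∀ m ∈ f.vars, m < B := ⟨f.vars.sup id + 1, fun m hm =>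
    Nat.lt_succ_of_le (Finset.le_sup (f := id) hm)⟩
  have hall : ∀ m, pderiv m f = 0 := by
    have hge : ∀ m, B ≤ m → pderiv m f = 0 := fun m hm =>
      pderiv_eq_zero_of_notMem_vars fun h => absurd (hB m h) (by omega)
    have hdown : ∀ k m, B ≤ m + k → pderiv m f = 0 := by
      intro k
      induction k with
      | zero => exact fun m hm => hge m hm
      | succ k ih => exact fun m hm => step m (ih (m + 1) (by omega))
    exact fun m => hdown B m (by omega)
  ext s
  rw [coeff_C]
  split_ifs with h
  · rw [← h, constantCoeff_eq]
  · obtain ⟨i, hi⟩ : ∃ i, s i ≠ 0 := by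
      by_contra hc
      push Not at hc
      exact h (Finsupp.ext fun i => (hc i).symm)
    have := coeff_pderiv f (s - Finsupp.single i 1) (i := i)
    have hs : s - Finsupp.single i 1 + Finsupp.single i 1 = s := by
      ext j
      by_cases hj : j = i
      · subst hj; simp; omega
      · simp [Ne.symm hj]
    rw [hall i, hs, coeff_zero, eq_comm] at this
    refine (mul_eq_zero.mp this).resolve_right ?_
    positivity

end LenardAux

open MvPolynomial Finset LenardAux in
theorem isLenardSequence_lenard : IsLenardSequence lenard where
  zero := by rw [lenard]
  recursion := by
    intro n
    induction n using Nat.strong_induction_on with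
    | _ n ih =>
      have h := convolution n
      rw [Finset.sum_eq_single (0, n)] at h
      · have h0 : lenard 0 ≠ 0 := by
          intro h0
          have := two_mul_lenard_zero
          rw [h0, mul_zero] at this
          exact zero_ne_one this
        exact (sub_eq_zero.mp ((mul_eq_zero.mp h).resolve_left h0)).symm
      · rintro ⟨i, j⟩ hp hne
        rw [HasAntidiagonal.mem_antidiagonal] at hp
        have hj : j < n := by
          rcases Nat.eq_zero_or_pos i with hi | hi
          · exact absurd (by ext <;> simp at hp ⊢ <;> omega) hne
          · simp at hp; omega
        simp only
        rw [ih j hj, sub_self, mul_zero]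
      · intro hn
        exact absurd (by simp) hn
  constant_term := constantCoeff_lenard_succ

open MvPolynomial LenardAux in
theorem IsLenardSequence.eq_lenard {L : ℕ → MvPolynomial ℕ ℚ} (hL : IsLenardSequence L) :
    L = lenard := by
  funext n
  induction n with
  | zero => rw [hL.zero, isLenardSequence_lenard.zero]
  | succ n ih =>
    have h : totalDeriv (L (n + 1) - lenard (n + 1)) = 0 := by
      rw [map_sub, hL.recursion, isLenardSequence_lenard.recursion, ih, sub_self]
    have := eq_C_of_totalDeriv_eq_zero h
    rw [map_sub, hL.constant_term, isLenardSequence_lenard.constant_term, sub_zero, C_0] at this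
    exact sub_eq_zero.mp this

/-- The value at `z` of the differential polynomial `L_N[u]`, for a function `u` of `z`. -/
noncomputable def lenardEval (N : ℕ) (u : ℂ → ℂ) (z : ℂ) : ℂ :=
  MvPolynomial.aeval (fun k => iteratedDeriv k u z) (lenard N)

/-- The left-hand side of the `N`-th equation of the second Painlevé hierarchy,
`P₂^(N)[w, α] = (d/dz + 2w) L_N[w' - w²] - z w - α`, at the point `z`. -/
noncomputable def painleveII (N : ℕ) (α : ℂ) (w : ℂ → ℂ) (z : ℂ) : ℂ :=
  deriv (lenardEval N fun x => deriv w x - w x ^ 2) z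
    + 2 * w z * lenardEval N (fun x => deriv w x - w x ^ 2) z - z * w z - α

open Polynomial in
/-- `w` is a rational function of `z` which solves `P₂^(N)[w, α] = 0`. The values of `w` at the
finitely many zeros of the denominator `q` play no role. -/
def IsRationalSolution (N : ℕ) (α : ℂ) (w : ℂ → ℂ) : Prop :=
  ∃ p q : ℂ[X], q ≠ 0 ∧
    ∀ z, q.eval z ≠ 0 → w z = p.eval z / q.eval z ∧ painleveII N α w z = 0

open Polynomial in
/-- `Q 0, Q 1, Q 2, …` are the polynomials `Q_n^(N)` attached to the rational solutions of the
`N`-th equation of the second Painlevé hierarchy: they are monic, `Q 0 = 1`, and for each `n ≥ 1`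
the function `w(z; n) = d/dz ln (Q_{n-1}(z) / Q_n(z))` is the rational solution with `α = n`. -/
structure IsYablonskiiVorobevFamily (N : ℕ) (Q : ℕ → ℂ[X]) : Prop where
  zero : Q 0 = 1
  monic : ∀ n, (Q n).Monic
  solution : ∀ n : ℕ, 1 ≤ n →
    IsRationalSolution N n (logDeriv fun z => (Q (n - 1)).eval z / (Q n).eval z)

/-! Everything is read off at infinity. For `A = Q (n - 1)` and `B = Q n`, the function `w = (ln (A
/ B))'` is a rational function vanishing at infinity, and `z * w` tends to `deg A - deg B`. Hence `u
= w' - w²` vanishes at infinity. Since `L_N` has no constant term for `N ≥ 1`, so do `L_N[u]`, its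
derivative and `2 w L_N[u]`. Letting `z → ∞` in the equation leaves `deg B - deg A = α = n`, and
summing over `n` gives the degree.

Limits are replaced by degree comparisons: `IsProperRational` is stable under sums, products and
derivatives, hence under differential polynomials without constant term (`aeval_sub_constantCoeff`);
`id_mul_logDeriv_div_sub` supplies the residue and `eq_zero_of_eq_const` takes the limit. -/

open Polynomial in
/-- `f` agrees, off the zeros of a nonzero polynomial `q`, with a rational function `p / q` that
vanishes at infinity. -/
def IsProperRational (f : ℂ → ℂ) : Prop :=
  ∃ p q : ℂ[X], q ≠ 0 ∧ p.degree < q.degree ∧ ∀ z, q.eval z ≠ 0 → f z = p.eval z / q.eval z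

/-! ### Closure properties of rational functions vanishing at infinity. -/

namespace IsProperRational

open Polynomial

theorem degree_mul_lt_left {p q r : ℂ[X]} (h : p.degree < q.degree) (hr : r ≠ 0) :
    (p * r).degree < (q * r).degree := by
  have hq : q ≠ 0 := by
    rintro rfl
    simp at h
  by_cases hp : p = 0
  · rw [hp, zero_mul, degree_zero, bot_lt_iff_ne_bot, Ne, degree_eq_bot]
    exact mul_ne_zero hq hr
  · rw [degree_eq_natDegree hp, degree_eq_natDegree hq, Nat.cast_lt] at h
    rw [degree_eq_natDegree (mul_ne_zero hp hr), degree_eq_natDegree (mul_ne_zero hq hr),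
      natDegree_mul hp hr, natDegree_mul hq hr, Nat.cast_lt]
    lia

theorem zero : IsProperRational 0 :=
  ⟨0, 1, one_ne_zero, by simp, fun z _ => by simp⟩

theorem add {f g : ℂ → ℂ} (hf : IsProperRational f) (hg : IsProperRational g) :
    IsProperRational (f + g) := by
  obtain ⟨p, q, hq, hpq, hf⟩ := hf
  obtain ⟨r, s, hs, hrs, hg⟩ := hg
  refine ⟨p * s + r * q, q * s, mul_ne_zero hq hs, ?_, fun z hz => ?_⟩
  · refine (degree_add_le _ _).trans_lt (max_lt (degree_mul_lt_left hpq hs) ?_)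
    rw [mul_comm q s]
    exact degree_mul_lt_left hrs hq
  · rw [eval_mul, mul_ne_zero_iff] at hz
    rw [Pi.add_apply, hf z hz.1, hg z hz.2, eval_add, eval_mul, eval_mul, eval_mul,
      div_add_div _ _ hz.1 hz.2, mul_comm (q.eval z) (r.eval z)]

theorem const_mul {f : ℂ → ℂ} (c : ℂ) (hf : IsProperRational f) :
    IsProperRational fun z => c * f z := by
  obtain ⟨p, q, hq, hpq, hf⟩ := hf
  refine ⟨C c * p, q, hq, ?_, fun z hz => ?_⟩
  · rw [← smul_eq_C_mul]
    exact (degree_smul_le c p).trans_lt hpq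
  · simp only [hf z hz, eval_mul, eval_C, mul_div_assoc]

theorem sub {f g : ℂ → ℂ} (hf : IsProperRational f) (hg : IsProperRational g) :
    IsProperRational (f - g) := by
  have h : f - g = f + fun z => -1 * g z := by
    ext z
    simp [sub_eq_add_neg]
  rw [h]
  exact hf.add (hg.const_mul _)

theorem mul {f g : ℂ → ℂ} (hf : IsProperRational f) (hg : IsProperRational g) :
    IsProperRational (f * g) := by
  obtain ⟨p, q, hq, hpq, hf⟩ := hf
  obtain ⟨r, s, hs, hrs, hg⟩ := hg
  refine ⟨p * r, q * s, mul_ne_zero hq hs, ?_, fun z hz => ?_⟩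
  · refine lt_of_le_of_lt ?_ (degree_mul_lt_left hpq hs)
    rw [degree_mul, degree_mul]
    gcongr
  · rw [eval_mul, mul_ne_zero_iff] at hz
    rw [Pi.mul_apply, hf z hz.1, hg z hz.2, eval_mul, eval_mul, div_mul_div_comm]

theorem deriv {f : ℂ → ℂ} (hf : IsProperRational f) : IsProperRational (deriv f) := by
  obtain ⟨p, q, hq, hpq, hf⟩ := hf
  refine ⟨derivative p * q - p * derivative q, q * q, mul_ne_zero hq hq, ?_, fun z hz => ?_⟩
  · refine (degree_sub_le _ _).trans_lt (max_lt ?_ ?_)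
    · exact degree_mul_lt_left ((degree_derivative_le (p := p)).trans_lt hpq) hq
    · refine lt_of_le_of_lt ?_ (degree_mul_lt_left hpq hq)
      rw [degree_mul, degree_mul]
      gcongr
      exact degree_derivative_le
  · rw [eval_mul, mul_self_ne_zero] at hz
    -- The zeros of `q` form a closed set, so the formula for `f` holds near `z` and may be
    -- differentiated.
    have he : f =ᶠ[nhds z] fun x => p.eval x / q.eval x := by
      filter_upwards [q.continuous.continuousAt.eventually_ne hz] with x hx using hf x hx
    rw [he.deriv_eq, ((p.hasDerivAt z).fun_div (q.hasDerivAt z) hz).deriv]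
    simp [sq]

theorem iteratedDeriv {f : ℂ → ℂ} (hf : IsProperRational f) (k : ℕ) :
    IsProperRational (iteratedDeriv k f) := by
  induction k with
  | zero => rwa [iteratedDeriv_zero]
  | succ k ih =>
    rw [iteratedDeriv_succ]
    exact ih.deriv

/-- A differential polynomial in a proper rational function is a proper rational function up to
its constant term. -/
theorem aeval_sub_constantCoeff {u : ℂ → ℂ} (hu : IsProperRational u) (P : MvPolynomial ℕ ℚ) :
    IsProperRational fun z => MvPolynomial.aeval (fun k => _root_.iteratedDeriv k u z) P
      - ((MvPolynomial.constantCoeff P : ℚ) : ℂ) := by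
  induction P using MvPolynomial.induction_on with
  | C a =>
    convert zero using 1
    ext z
    simp
  | add p q hp hq =>
    convert hp.add hq using 1
    ext z
    simp only [map_add, Pi.add_apply]
    push_cast
    ring
  | mul_X p i hp =>
    -- With `c` the constant term of `p`, split `p * X i = (p - c) * X i + c * X i`; the product
    -- itself has constant term `0`.
    convert (hp.mul (hu.iteratedDeriv i)).add
      ((hu.iteratedDeriv i).const_mul ((MvPolynomial.constantCoeff p : ℚ) : ℂ)) using 1
    ext z
    simp only [map_mul, MvPolynomial.aeval_X, MvPolynomial.constantCoeff_X, Pi.add_apply,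
      Pi.mul_apply]
    push_cast
    ring

/-- This is where `1 ≤ N` enters: `L_0 = 1/2` does not vanish at infinity. -/
theorem lenardEval {u : ℂ → ℂ} (hu : IsProperRational u) {N : ℕ} (hN : 1 ≤ N) :
    IsProperRational (lenardEval N u) := by
  obtain ⟨N, rfl⟩ := Nat.exists_eq_add_of_le' hN
  convert hu.aeval_sub_constantCoeff (lenard (N + 1)) using 1
  ext z
  rw [LenardAux.constantCoeff_lenard_succ, Rat.cast_zero, sub_zero, _root_.lenardEval]

/-- A proper rational function which is constant off a finite set is zero there. -/
theorem eq_zero_of_eq_const {f : ℂ → ℂ} (hf : IsProperRational f) {c : ℂ} {r : ℂ[X]} (hr : r ≠ 0)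
    (h : ∀ z, r.eval z ≠ 0 → f z = c) : c = 0 := by
  obtain ⟨p, q, hq, hpq, hf⟩ := hf
  -- The factor `q * r` kills the points where `f` is uncontrolled, so the identity can be checked
  -- at every `z`.
  have hzero : (p - C c * q) * (q * r) = 0 := by
    refine Polynomial.funext fun z => ?_
    by_cases hz : (q * r).eval z = 0
    · rw [eval_mul, hz, mul_zero, eval_zero]
    · rw [eval_mul] at hz
      obtain ⟨hqz, hrz⟩ := mul_ne_zero_iff.mp hz
      have := hf z hqz
      rw [h z hrz, eq_div_iff hqz] at this
      simp [← this]
  have hp : p = C c * q :=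
    sub_eq_zero.mp ((mul_eq_zero.mp hzero).resolve_right (mul_ne_zero hq hr))
  by_contra hc
  rw [hp, degree_C_mul hc] at hpq
  exact hpq.ne rfl

/-! ### Logarithmic derivatives at infinity. -/

/-- The Euler operator `z d/dz` multiplies the leading term by the degree, so the leading terms
cancel. -/
theorem degree_X_mul_derivative_sub_lt {A : ℂ[X]} (hA : A ≠ 0) :
    (X * derivative A - C (A.natDegree : ℂ) * A).degree < A.degree := by
  rw [degree_eq_natDegree hA, degree_lt_iff_coeff_zero]
  intro m hm
  rw [coeff_sub, coeff_C_mul]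
  rcases hm.eq_or_lt with h | h
  · rcases m with _ | m
    · simp [h]
    · rw [coeff_X_mul, coeff_derivative, h]
      push_cast
      ring
  · rw [coeff_eq_zero_of_natDegree_lt h]
    rcases m with _ | m
    · simp
    · rw [coeff_X_mul, coeff_derivative, coeff_eq_zero_of_natDegree_lt h]
      simp

theorem logDeriv_eval_div {A B : ℂ[X]} {z : ℂ} (hA : A.eval z ≠ 0) (hB : B.eval z ≠ 0) :
    logDeriv (fun z => A.eval z / B.eval z) z =
      (derivative A).eval z / A.eval z - (derivative B).eval z / B.eval z := by
  rw [logDeriv_div z hA hB A.differentiableAt B.differentiableAt, logDeriv_apply, logDeriv_apply,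
    Polynomial.deriv, Polynomial.deriv]

theorem logDeriv_div {A B : ℂ[X]} (hA : A ≠ 0) (hB : B ≠ 0) :
    IsProperRational (logDeriv fun z => A.eval z / B.eval z) := by
  refine ⟨derivative A * B - derivative B * A, A * B, mul_ne_zero hA hB, ?_, fun z hz => ?_⟩
  · refine (degree_sub_le _ _).trans_lt (max_lt ?_ ?_)
    · exact degree_mul_lt_left (degree_derivative_lt hA) hB
    · rw [mul_comm A B]
      exact degree_mul_lt_left (degree_derivative_lt hB) hA
  · rw [eval_mul, mul_ne_zero_iff] at hz
    rw [logDeriv_eval_div hz.1 hz.2, div_sub_div _ _ hz.1 hz.2]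
    simp [mul_comm]

/-- The residue at infinity of the logarithmic derivative of `A / B` is `deg A - deg B`. -/
theorem id_mul_logDeriv_div_sub {A B : ℂ[X]} (hA : A ≠ 0) (hB : B ≠ 0) :
    IsProperRational fun z => z * logDeriv (fun z => A.eval z / B.eval z) z
      - (A.natDegree - B.natDegree) := by
  refine ⟨(X * derivative A - C (A.natDegree : ℂ) * A) * B
    - (X * derivative B - C (B.natDegree : ℂ) * B) * A, A * B, mul_ne_zero hA hB, ?_,
    fun z hz => ?_⟩
  · refine (degree_sub_le _ _).trans_lt (max_lt ?_ ?_)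
    · exact degree_mul_lt_left (degree_X_mul_derivative_sub_lt hA) hB
    · rw [mul_comm A B]
      exact degree_mul_lt_left (degree_X_mul_derivative_sub_lt hB) hA
  · rw [eval_mul, mul_ne_zero_iff] at hz
    obtain ⟨hAz, hBz⟩ := hz
    simp only [logDeriv_eval_div hAz hBz, eval_sub, eval_mul, eval_X, eval_C]
    field_simp
    ring

end IsProperRational

/-! ### Degree increments and their sum. -/

open Polynomial in
/-- If the logarithmic derivative of `A / B` solves the `N`-th equation of the second Painlevé
hierarchy with parameter `α`, then `α = deg B - deg A`. -/
theorem IsRationalSolution.natDegree_sub_natDegree {N : ℕ} (hN : 1 ≤ N) {α : ℂ} {A B : ℂ[X]}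
    (hA : A ≠ 0) (hB : B ≠ 0)
    (h : IsRationalSolution N α (logDeriv fun z => A.eval z / B.eval z)) :
    (B.natDegree : ℂ) - A.natDegree = α := by
  have hw := IsProperRational.logDeriv_div hA hB
  have hres := IsProperRational.id_mul_logDeriv_div_sub hA hB
  obtain ⟨_, q, hq, hsol⟩ := h
  set w := logDeriv fun z => A.eval z / B.eval z
  have hu : IsProperRational fun x => deriv w x - w x ^ 2 := by
    convert hw.deriv.sub (hw.mul hw) using 1
    ext z
    simp [sq]
  have hL := hu.lenardEval hN
  have hE := (hL.deriv.add ((hw.mul hL).const_mul 2)).sub hres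
  -- The equation moves `z * w` and `α` across, so the proper rational function in `hE` is the
  -- constant `deg A - deg B + α`, which must be zero.
  have := hE.eq_zero_of_eq_const (c := (A.natDegree - B.natDegree) + α) hq fun z hz => by
    have h0 := (hsol z hz).2
    rw [painleveII] at h0
    simp only [Pi.sub_apply, Pi.add_apply, Pi.mul_apply]
    linear_combination h0
  linear_combination -this

open Polynomial in
theorem IsYablonskiiVorobevFamily.natDegree_succ {N : ℕ} (hN : 1 ≤ N) {Q : ℕ → ℂ[X]}
    (hQ : IsYablonskiiVorobevFamily N Q) (n : ℕ) :
    (Q (n + 1)).natDegree = (Q n).natDegree + (n + 1) := by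
  have h := (hQ.solution (n + 1) n.succ_pos).natDegree_sub_natDegree hN
    (hQ.monic _).ne_zero (hQ.monic _).ne_zero
  rw [Nat.add_sub_cancel, sub_eq_iff_eq_add'] at h
  exact_mod_cast h

open Polynomial in
theorem mainTheorem2 (N : ℕ) (hN : 1 ≤ N) (Q : ℕ → ℂ[X])
    (hQ : IsYablonskiiVorobevFamily N Q) (n : ℕ) :
    (Q n).natDegree = ∑ i ∈ Finset.Icc 1 n, i ∧ (Q n).natDegree = n * (n + 1) / 2 := by
  have h : (Q n).natDegree = ∑ i ∈ Finset.Icc 1 n, i := by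
    induction n with
    | zero => simp [hQ.zero]
    | succ n ih => rw [hQ.natDegree_succ hN, ih, Finset.sum_Icc_succ_top (by omega)]
  refine ⟨h, ?_⟩
  -- Doubling keeps truncated division out of the induction.
  have hsum : ∀ m : ℕ, (∑ i ∈ Finset.Icc 1 m, i) * 2 = m * (m + 1) := by
    intro m
    induction m with
    | zero => simp
    | succ m ih =>
      rw [Finset.sum_Icc_succ_top (by omega), add_mul, ih]
      ring
  rw [h, ← hsum, Nat.mul_div_cancel _ two_pos]
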